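/- Let $M \subseteq \mathcal{B}(\mathcal{H})$ be a von Neumann algebra with a faithful normal semifinite trace $\tau$, and let $r \in M$ be a nonzero projection. A linear functional on the reduced algebra $M_r := rMr$ is called normal if it is ultraweakly continuous, and a positive linear functional $\varphi$ on $M_r$ is called singular if the only positive normal linear functional $\psi$ on $M_r$ with $\varphi - \psi \ge 0$ is $\psi = 0$. Let $K$ be a weak*-compact convex set of positive functionals in the closed unit ball of the Banach space dual $M^*$ such that the restriction $\mu|_{M_r}$ is singular for every $\mu \in K$. Then for every nonzero projection $f \in M_r$ there is a nonzero projection $p \in M$ with $p \le f$ such that $\mu(p) = 0$ for all $\mu \in K$. -/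

import Mathlib

namespace VNA

open scoped ComplexOrder ENNReal NNReal InnerProductSpace

variable {H : Type*} [NormedAddCommGroup H] [InnerProductSpace ℂ H] [CompleteSpace H]

/-- The elements of a von Neumann algebra `M ⊆ B(H)` as a type, with the operator norm and the
Loewner order of `B(H)`. -/
abbrev Elem (M : VonNeumannAlgebra H) : Type _ := M.toStarSubalgebra

/-- A faithful normal semifinite trace on `M`. A trace is a map `M₊ → [0, ∞]`; only the values
of `τ` at positive elements matter. -/
structure IsFNSTrace (M : VonNeumannAlgebra H) (τ : Elem M → ℝ≥0∞) : Prop where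
  add : ∀ x y : Elem M, 0 ≤ x → 0 ≤ y → τ (x + y) = τ x + τ y
  smul : ∀ (c : ℝ≥0) (x : Elem M), 0 ≤ x → τ (((c : ℝ) : ℂ) • x) = (c : ℝ≥0∞) * τ x
  tracial : ∀ x : Elem M, τ (star x * x) = τ (x * star x)
  faithful : ∀ x : Elem M, 0 ≤ x → τ x = 0 → x = 0
  normal : ∀ (D : Set (Elem M)) (x : Elem M), D.Nonempty → DirectedOn (· ≤ ·) D →
    (∀ d ∈ D, 0 ≤ d) → IsLUB D x → IsLUB (τ '' D) (τ x)
  semifinite : ∀ x : Elem M, 0 ≤ x → x ≠ 0 → ∃ y : Elem M, 0 ≤ y ∧ y ≤ x ∧ y ≠ 0 ∧ τ y < ∞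

/-- The ultraweak (`σ`-weak) topology on `M`: the coarsest topology for which all the functionals
`x ↦ ∑ₙ ⟪ξₙ, x ηₙ⟫` with `∑ₙ ‖ξₙ‖² < ∞`, `∑ₙ ‖ηₙ‖² < ∞` are continuous. -/
@[reducible]
noncomputable def ultraweakTopology (M : VonNeumannAlgebra H) : TopologicalSpace (Elem M) :=
  ⨅ (ξ : ℕ → H) (η : ℕ → H) (_ : Summable fun n => ‖ξ n‖ ^ 2) (_ : Summable fun n => ‖η n‖ ^ 2),
    TopologicalSpace.induced (fun x : Elem M => ∑' n, ⟪ξ n, (x : H →L[ℂ] H) (η n)⟫_ℂ) inferInstance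

/-- The reduced algebra `M_r = r M r` of a projection `r` of `M`. -/
def corner (M : VonNeumannAlgebra H) (r : Elem M) (hr : IsStarProjection r) :
    NonUnitalStarSubalgebra ℂ (Elem M) where
  carrier := {x | ∃ y : Elem M, x = r * y * r}
  add_mem' := by
    rintro _ _ ⟨a, rfl⟩ ⟨b, rfl⟩
    exact ⟨a + b, by rw [mul_add, add_mul]⟩
  zero_mem' := ⟨0, by simp⟩
  mul_mem' := by
    rintro _ _ ⟨a, rfl⟩ ⟨b, rfl⟩
    exact ⟨a * r * r * b, by simp only [mul_assoc]⟩
  smul_mem' := by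
    rintro c _ ⟨a, rfl⟩
    exact ⟨c • a, by simp⟩
  star_mem' := by
    rintro _ ⟨a, rfl⟩
    exact ⟨star a, by simp [hr.isSelfAdjoint.star_eq, mul_assoc]⟩

section Functionals

variable {M : VonNeumannAlgebra H} {N : NonUnitalStarSubalgebra ℂ (Elem M)}

/-- Positivity of a linear functional on a `*`-subalgebra `N` of `M`. -/
def IsPositive (φ : N →ₗ[ℂ] ℂ) : Prop := ∀ x : N, 0 ≤ φ (star x * x)

/-- Normality of a linear functional on a `*`-subalgebra `N` of `M`: continuity for the ultraweak
topology. On `r M r` the ultraweak topology of its action on `r H` is the one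
inherited from `M`. -/
def IsNormal (φ : N →ₗ[ℂ] ℂ) : Prop :=
  @Continuous N ℂ ((ultraweakTopology M).induced Subtype.val) inferInstance φ

/-- A positive functional is singular if it dominates no nonzero positive normal functional. -/
def IsSingular (φ : N →ₗ[ℂ] ℂ) : Prop :=
  IsPositive φ ∧ ∀ ψ : N →ₗ[ℂ] ℂ, IsPositive ψ → IsNormal ψ → IsPositive (φ - ψ) → ψ = 0

/-- The restriction of a bounded functional on `M` to `N`. -/
noncomputable def restrict (N : NonUnitalStarSubalgebra ℂ (Elem M)) (μ : WeakDual ℂ (Elem M)) : N →ₗ[ℂ] ℂ where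
  toFun x := μ (x : Elem M)
  map_add' x y := map_add μ (x : Elem M) (y : Elem M)
  map_smul' c x := map_smul μ c (x : Elem M)

end Functionals

/-- The positive functionals in the closed unit ball of `M*`. -/
def positiveUnitBall (M : VonNeumannAlgebra H) : Set (WeakDual ℂ (Elem M)) :=
  {μ | ‖WeakDual.toStrongDual μ‖ ≤ 1 ∧ ∀ x : Elem M, 0 ≤ μ (star x * x)}

end VNA

/-! Fix a vector `ξ` and one `μ ∈ K`. Zorn's lemma gives a maximal projection `e ≤ f` with `ε⁻¹ ‖e
ξ‖² ≤ μ e`; thus `‖e ξ‖² ≤ ε`, and `μ p ≤ ε⁻¹ ‖p ξ‖²` for every projection `p ≤ f - e`. Dyadic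
approximation by spectral projections extends this domination to the corner of `f - e`. A Riesz
argument then yields `η` with `μ (f - e) = ⟪η, (f - e) ξ⟫` whose vector functional is at most a
multiple of `μ`. Singularity forces `(f - e) η = 0`, hence `μ (f - e) = 0`
(`exists_projection_apply_eq_zero`).

The projection `f - e` depends on `μ`. Sion's minimax theorem on the compact convex set `K` replaces
it by a single `0 ≤ x ≤ f`, close to `f` at `ξ`, with `μ x` uniformly small
(`exists_forall_apply_lt`), and a spectral cut of `x` at `1 / 2` restores a projection. Iterating
with geometrically decreasing errors gives a decreasing sequence of projections. Its infimum is
annihilated by all of `K`, and is nonzero because the total loss at `ξ` is at most `‖ξ‖ / 2`. -/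

namespace VNA

open scoped ComplexOrder ENNReal NNReal InnerProductSpace

variable {H : Type*} [NormedAddCommGroup H] [InnerProductSpace ℂ H] [CompleteSpace H]
variable {M : VonNeumannAlgebra H}

/-! ### Projections and functional calculus inside `M` -/

theorem mem_of_forall_commute {x : H →L[ℂ] H} (h : ∀ y ∈ M.commutant, Commute x y) : x ∈ M := by
  rw [← M.commutant_commutant, VonNeumannAlgebra.mem_commutant_iff]
  exact fun y hy => (h y hy).symm

theorem commute_of_mem {x y : H →L[ℂ] H} (hx : x ∈ M) (hy : y ∈ M.commutant) : Commute x y :=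
  VonNeumannAlgebra.mem_commutant_iff.1 hy x hx

theorem cfcₙ_mem {x : H →L[ℂ] H} (hx : x ∈ M) (g : ℝ → ℝ) : cfcₙ g x ∈ M :=
  mem_of_forall_commute fun _ hy => (commute_of_mem hx hy).cfcₙ_real g

/-- The projection onto a closed subspace invariant under the commutant belongs to `M`. -/
theorem starProjection_mem (U : Submodule ℂ H) [U.HasOrthogonalProjection]
    (h : ∀ y ∈ M.commutant, ∀ v ∈ U, y v ∈ U) : U.starProjection ∈ M := by
  rw [VonNeumannAlgebra.IsStarProjection.mem_iff isStarProjection_starProjection]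
  intro y hy
  rw [Submodule.range_starProjection]
  exact fun v hv => h y hy v hv

/-- A positive element of `M` is of the form `b⋆ b` with `b` in `M`. -/
theorem exists_star_mul_self {a : Elem M} (ha : 0 ≤ a) : ∃ b : Elem M, a = star b * b := by
  have ha' : (0 : H →L[ℂ] H) ≤ a := ha
  have hs : CFC.sqrt (a : H →L[ℂ] H) ∈ M :=
    mem_of_forall_commute fun y hy => (commute_of_mem a.2 hy).cfcₙ_nnreal _
  refine ⟨⟨_, hs⟩, Subtype.ext ?_⟩
  change (a : H →L[ℂ] H) = star (CFC.sqrt (a : H →L[ℂ] H)) * CFC.sqrt (a : H →L[ℂ] H)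
  rw [(CFC.sqrt_nonneg _).star_eq, CFC.sqrt_mul_sqrt_self _ ha']

theorem coe_isStarProjection {p : Elem M} (hp : IsStarProjection p) :
    IsStarProjection (p : H →L[ℂ] H) :=
  hp.map M.toStarSubalgebra.subtype

theorem isStarProjection_of_coe {p : Elem M} (hp : IsStarProjection (p : H →L[ℂ] H)) :
    IsStarProjection p :=
  ⟨Subtype.ext hp.isIdempotentElem, Subtype.ext hp.isSelfAdjoint⟩

/-- The range projection of an element of `M` lies in `M`. -/
theorem exists_range_projection {a : H →L[ℂ] H} (ha : a ∈ M) :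
    ∃ q ∈ M, IsStarProjection q ∧ q * a = a ∧ ∀ b : H →L[ℂ] H, b * a = 0 → b * q = 0 := by
  let U : Submodule ℂ H := a.range.topologicalClosure
  have hmem (v : H) : a v ∈ U := Submodule.le_topologicalClosure _ ⟨v, rfl⟩
  refine ⟨U.starProjection, starProjection_mem U ?_, isStarProjection_starProjection, ?_, ?_⟩
  · intro y hy v hv
    refine map_mem_closure (s := (a.range : Set H)) (t := (a.range : Set H)) y.continuous hv ?_
    rintro _ ⟨w, rfl⟩
    exact ⟨y w, congr($((commute_of_mem ha hy).eq) w)⟩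
  · ext v
    exact Submodule.starProjection_eq_self_iff.2 (hmem v)
  · intro b hb
    ext v
    have hle : U ≤ b.ker := by
      refine Submodule.topologicalClosure_minimal _ ?_ b.isClosed_ker
      rintro _ ⟨w, rfl⟩
      exact congr($hb w)
    exact hle (U.starProjection_apply_mem v)

/-! ### Spectral cuts at one half -/

/-- A spectral projection of a positive contraction for the part of the spectrum above `1 / 2`. -/
theorem exists_half_spectral_projection {x : H →L[ℂ] H} (hxM : x ∈ M) (hx0 : 0 ≤ x) (hx1 : x ≤ 1) :
    ∃ q ∈ M, IsStarProjection q ∧ q ≤ 2 * x ∧ 1 - q ≤ 2 * (1 - x) := by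
  set d : H →L[ℂ] H := 2 * x - 1 with hd
  have hdM : d ∈ M := by
    rw [hd, two_mul]
    exact sub_mem (add_mem hxM hxM) (one_mem M)
  have hdsa : IsSelfAdjoint d := by
    rw [hd, two_mul]
    exact (hx0.isSelfAdjoint.add hx0.isSelfAdjoint).sub (.one _)
  have hpM : d⁺ ∈ M := cfcₙ_mem hdM _
  obtain ⟨q, hqM, hq, hqd, hqk⟩ := exists_range_projection hpM
  have hsq := hq.isSelfAdjoint.star_eq
  have hqq : q * q = q := hq.isIdempotentElem
  have hdec : d⁺ - d⁻ = d := CFC.posPart_sub_negPart d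
  have hdq : d⁺ * q = d⁺ := by
    simpa [hsq, (CFC.posPart_nonneg d).star_eq] using congr(star $hqd)
  have hnq : d⁻ * q = 0 := hqk _ (CFC.negPart_mul_posPart d)
  have hqn : q * d⁻ = 0 := by
    simpa [hsq, (CFC.negPart_nonneg d).star_eq] using congr(star $hnq)
  refine ⟨q, hqM, hq, ?_, ?_⟩
  · have h1 : 0 ≤ star (1 - q) * (x + x) * (1 - q) :=
      star_left_conjugate_nonneg (add_nonneg hx0 hx0) _
    -- On the range of `q` one has `2 * x = 1 + d⁺`, so subtracting `q` leaves `d⁺`; off it nothing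
    -- is subtracted.
    have h2 : 2 * x - q = star (1 - q) * (x + x) * (1 - q) + d⁺ := by
      have : x + x = 1 + (d⁺ - d⁻) := by rw [hdec, hd, two_mul]; abel
      rw [two_mul, this, star_sub, star_one, hsq]
      simp only [mul_add, add_mul, mul_sub, sub_mul, mul_one, one_mul, hqq, hqd, hdq, hnq, hqn,
        zero_mul]
      abel
    rw [← sub_nonneg, h2]
    exact add_nonneg h1 (CFC.posPart_nonneg d)
  · have h1 : 0 ≤ star q * ((1 - x) + (1 - x)) * q :=
      star_left_conjugate_nonneg (add_nonneg (sub_nonneg.2 hx1) (sub_nonneg.2 hx1)) _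
    have h2 : 2 * (1 - x) - (1 - q) = star q * ((1 - x) + (1 - x)) * q + d⁻ := by
      have : (1 - x) + (1 - x) = 1 - (d⁺ - d⁻) := by rw [hdec, hd, two_mul]; abel
      rw [two_mul, this, hsq]
      simp only [mul_sub, sub_mul, mul_one, hqq, hqd, hdq, hqn, zero_mul]
      abel
    rw [← sub_nonneg, h2]
    exact add_nonneg h1 (CFC.negPart_nonneg d)

/-- A spectral projection, relative to a projection `f`, of an element between `0` and `f`. -/
theorem exists_half_spectral_projection_le {f x : Elem M} (hf : IsStarProjection f)
    (hx0 : 0 ≤ x) (hxf : x ≤ f) :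
    ∃ q : Elem M, IsStarProjection q ∧ q ≤ f ∧ q ≤ x + x ∧ f - q ≤ (f - x) + (f - x) := by
  have hf' := coe_isStarProjection hf
  have hx0' : (0 : H →L[ℂ] H) ≤ x := hx0
  have hxf' : (x : H →L[ℂ] H) ≤ f := hxf
  obtain ⟨q, hqM, hq, hq1, hq2⟩ :=
    exists_half_spectral_projection x.2 hx0' (hxf'.trans hf'.le_one)
  have hfx := hf'.mul_right_and_mul_left_of_nonneg_of_le hx0' hxf'
  have hff : (f : H →L[ℂ] H) * f = f := hf'.isIdempotentElem
  rw [two_mul] at hq1 hq2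
  -- Compressing `q ≤ x + x` by `1 - f`, which annihilates `x`, forces `q` to vanish off `f`.
  have hcomp : (1 - (f : H →L[ℂ] H)) * q = 0 := by
    have h1 : (1 - (f : H →L[ℂ] H)) * q * (1 - f) ≤ 0 := by
      have := star_left_conjugate_le_conjugate hq1 (1 - (f : H →L[ℂ] H))
      rw [hf'.one_sub.isSelfAdjoint.star_eq] at this
      refine this.trans_eq ?_
      simp [mul_add, sub_mul, hfx.2]
    have h2 : 0 ≤ (1 - (f : H →L[ℂ] H)) * q * (1 - f) := by
      have := star_left_conjugate_nonneg hq.nonneg (1 - (f : H →L[ℂ] H))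
      rwa [hf'.one_sub.isSelfAdjoint.star_eq] at this
    have h3 : star (q * (1 - (f : H →L[ℂ] H))) * (q * (1 - f)) = 0 := by
      rw [star_mul, hf'.one_sub.isSelfAdjoint.star_eq, hq.isSelfAdjoint.star_eq, mul_assoc,
        ← mul_assoc q q, hq.isIdempotentElem.eq, ← mul_assoc]
      exact le_antisymm h1 h2
    have h4 := CStarRing.star_mul_self_eq_zero_iff _ |>.1 h3
    simpa [hf'.one_sub.isSelfAdjoint.star_eq, hq.isSelfAdjoint.star_eq] using congr(star $h4)
  have hfq : (f : H →L[ℂ] H) * q = q := by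
    rw [sub_mul, one_mul, sub_eq_zero] at hcomp
    exact hcomp.symm
  have hqf : q * (f : H →L[ℂ] H) = q := by
    simpa [hf'.isSelfAdjoint.star_eq, hq.isSelfAdjoint.star_eq] using congr(star $hfq)
  refine ⟨⟨q, hqM⟩, isStarProjection_of_coe hq, hq.le_of_mul_eq_right hf' hfq, hq1, ?_⟩
  have := star_left_conjugate_le_conjugate hq2 (f : H →L[ℂ] H)
  rw [hf'.isSelfAdjoint.star_eq] at this
  simp only [mul_add, add_mul, mul_sub, sub_mul, mul_one, hff, hfx.1, hfx.2, hfq, hqf] at this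
  exact this

theorem norm_le_one_of_le_projection {e x : Elem M} (he : IsStarProjection e) (hx0 : 0 ≤ x)
    (hxe : x ≤ e) : ‖x‖ ≤ 1 := by
  have hx0' : (0 : H →L[ℂ] H) ≤ x := hx0
  have hxe' : (x : H →L[ℂ] H) ≤ e := hxe
  exact (CStarAlgebra.norm_le_one_iff_of_nonneg (x : H →L[ℂ] H) hx0').2
    (hxe'.trans (coe_isStarProjection he).le_one)

/-- A bounded additive functional which is nonpositive at the projections below `e` is nonpositive
at the positive elements below `e`. -/
theorem nonpos_of_nonpos_projection (l : Elem M →+ ℝ) {B : ℝ} (hB : ∀ x, ‖x‖ ≤ 1 → l x ≤ B)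
    {e : Elem M} (he : IsStarProjection e)
    (h : ∀ p : Elem M, IsStarProjection p → p ≤ e → l p ≤ 0) {x : Elem M} (hx0 : 0 ≤ x)
    (hxe : x ≤ e) : l x ≤ 0 := by
  -- The remainder `x + x - q` again lies between `0` and `e`, and `l q ≤ 0`, so each binary digit
  -- `q` of `x` halves the bound.
  have key (n : ℕ) : ∀ x : Elem M, 0 ≤ x → x ≤ e → l x ≤ B * (1 / 2) ^ n := by
    induction n with
    | zero => exact fun x hx0 hxe => by simpa using hB x (norm_le_one_of_le_projection he hx0 hxe)
    | succ n ih =>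
      intro x hx0 hxe
      obtain ⟨q, hq, hqe, hqx, hqx'⟩ := exists_half_spectral_projection_le he hx0 hxe
      have h1 := ih (x + x - q) (sub_nonneg.2 hqx) (by
        rw [← sub_nonneg] at hqx' ⊢
        convert hqx' using 1
        abel)
      have h2 := h q hq hqe
      rw [map_sub, map_add] at h1
      rw [pow_succ]
      linarith
  have hlim : Filter.Tendsto (fun n : ℕ => B * (1 / 2 : ℝ) ^ n) Filter.atTop (nhds (B * 0)) :=
    (tendsto_pow_atTop_nhds_zero_of_lt_one (by norm_num) (by norm_num)).const_mul B
  rw [mul_zero] at hlim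
  exact ge_of_tendsto' hlim fun n => key n x hx0 hxe

/-! ### Positive functionals and Cauchy–Schwarz -/

section PositiveFunctional

variable {φ : Elem M →ₗ[ℂ] ℂ} (hφ : ∀ x : Elem M, 0 ≤ φ (star x * x))

include hφ

theorem map_nonneg_of_nonneg {a : Elem M} (ha : 0 ≤ a) : 0 ≤ φ a := by
  obtain ⟨b, rfl⟩ := exists_star_mul_self ha
  exact hφ b

theorem re_map_mono {a b : Elem M} (hab : a ≤ b) : (φ a).re ≤ (φ b).re := by
  have := (Complex.nonneg_iff.1 (map_nonneg_of_nonneg hφ (sub_nonneg.2 hab))).1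
  rw [map_sub, Complex.sub_re] at this
  linarith

/-- Polarisation: the values at `star z * z` for `z = 1, x, 1 + x, 1 + i x` are all real. -/
theorem map_star_eq_conj (x : Elem M) : φ (star x) = starRingEnd ℂ (φ x) := by
  have h0 := (Complex.nonneg_iff.1 (hφ 1)).2
  have h1 := (Complex.nonneg_iff.1 (hφ x)).2
  have h2 := (Complex.nonneg_iff.1 (hφ (1 + x))).2
  have h3 := (Complex.nonneg_iff.1 (hφ (1 + Complex.I • x))).2
  simp only [star_one, star_add, star_smul, mul_add, add_mul, one_mul, mul_one, map_add, map_smul,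
    smul_mul_assoc, mul_smul_comm, Complex.add_im, smul_eq_mul, Complex.mul_im, Complex.mul_re,
    Complex.star_def, Complex.conj_I, Complex.I_re, Complex.I_im, Complex.neg_re,
    Complex.neg_im] at h0 h1 h2 h3
  apply Complex.ext <;> simp <;> linarith

theorem norm_map_star_mul_sq_le (x y : Elem M) :
    ‖φ (star x * y)‖ ^ 2 ≤ (φ (star x * x)).re * (φ (star y * y)).re := by
  let c : PreInnerProductSpace.Core ℂ (Elem M) :=
    { inner := fun x y => φ (star x * y)
      conj_inner_symm := fun x y => by rw [← map_star_eq_conj hφ, star_mul, star_star]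
      re_inner_nonneg := fun x => (Complex.nonneg_iff.1 (hφ x)).1
      add_left := fun x y z => by simp [add_mul]
      smul_left := fun x y r => by simp }
  have h := @InnerProductSpace.Core.inner_mul_inner_self_le ℂ (Elem M) _ _ _ c x y
  have hsymm : ‖φ (star y * x)‖ = ‖φ (star x * y)‖ := by
    rw [← star_star (star y * x), map_star_eq_conj hφ, RCLike.norm_conj, star_mul, star_star]
  change ‖φ (star x * y)‖ * ‖φ (star y * x)‖ ≤ (φ (star x * x)).re * (φ (star y * y)).re at h
  rwa [hsymm, ← sq] at h

end PositiveFunctional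

/-! ### Vector functionals and singularity -/

/-- Riesz representation of a functional bounded by a Hilbert seminorm. -/
theorem exists_inner_eq_of_norm_le {V : Type*} [AddCommGroup V] [Module ℂ V] (L : V →ₗ[ℂ] H)
    (g : V →ₗ[ℂ] ℂ) {c : ℝ} (h : ∀ v, ‖g v‖ ≤ c * ‖L v‖) :
    ∃ η ∈ L.range.topologicalClosure, ∀ v, g v = ⟪η, L v⟫_ℂ := by
  have hker : L.ker ≤ g.ker := fun v hv => by
    have h1 := h v
    rw [LinearMap.mem_ker.1 hv, norm_zero, mul_zero] at h1
    exact norm_le_zero_iff.1 h1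
  let g' : L.range →ₗ[ℂ] ℂ := L.ker.liftQ g hker ∘ₗ L.quotKerEquivRange.symm.toLinearMap
  have hg' (v : V) : g' ⟨L v, v, rfl⟩ = g v := by
    have : L.quotKerEquivRange.symm ⟨L v, v, rfl⟩ = L.ker.mkQ v :=
      LinearMap.quotKerEquivRange_symm_apply_image L v _
    simp [g', this]
  have hbound (w : L.range) : ‖g' w‖ ≤ c * ‖w‖ := by
    obtain ⟨_, v, rfl⟩ := w
    rw [hg']
    exact h v
  obtain ⟨G, hG, -⟩ := exists_extension_norm_eq L.range (g'.mkContinuous c hbound)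
  let U := L.range.topologicalClosure
  -- Projecting the Riesz vector onto the closed range keeps its pairing with the range and places
  -- it in that closure.
  refine ⟨U.starProjection ((InnerProductSpace.toDual ℂ H).symm G),
    U.starProjection_apply_mem _, fun v => ?_⟩
  have hv : U.starProjection (L v) = L v :=
    Submodule.starProjection_eq_self_iff.2 (Submodule.le_topologicalClosure _ ⟨v, rfl⟩)
  rw [Submodule.inner_starProjection_left_eq_right, hv, InnerProductSpace.toDual_symm_apply]
  rw [← hg' v]
  exact (hG ⟨L v, v, rfl⟩).symm

/-- A positive functional which on the corner of `e` is dominated by a vector functional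
dominates a vector functional that detects its value at `e`. -/
theorem exists_vector_functional_le {φ : Elem M →ₗ[ℂ] ℂ} (hφ : ∀ x : Elem M, 0 ≤ φ (star x * x))
    {e : Elem M} {ζ : H} {C : ℝ} (hC : 0 ≤ C)
    (h : ∀ y : Elem M, (φ (star (y * e) * (y * e))).re ≤ C * ‖(y : H →L[ℂ] H) ζ‖ ^ 2) :
    ∃ η : H, φ e = ⟪η, ζ⟫_ℂ ∧
      ∀ z : Elem M, ‖(z : H →L[ℂ] H) η‖ ^ 2 ≤ C * (φ (star z * z)).re := by
  have hre (x : Elem M) : 0 ≤ (φ (star x * x)).re := (Complex.nonneg_iff.1 (hφ x)).1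
  have hbound (x y : Elem M) : ‖φ (star x * (y * e))‖ ≤
      √(C * (φ (star x * x)).re) * ‖(y : H →L[ℂ] H) ζ‖ := by
    refine abs_le_of_sq_le_sq' ?_ (by positivity) |>.2
    refine (norm_map_star_mul_sq_le hφ x (y * e)).trans ?_
    rw [mul_pow, Real.sq_sqrt (mul_nonneg hC (hre x))]
    nlinarith [mul_le_mul_of_nonneg_left (h y) (hre x)]
  let L : Elem M →ₗ[ℂ] H :=
    { toFun := fun y => (y : H →L[ℂ] H) ζ
      map_add' := fun _ _ => rfl
      map_smul' := fun _ _ => rfl }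
  obtain ⟨η, hη, hrep⟩ := exists_inner_eq_of_norm_le L (φ ∘ₗ LinearMap.mulRight ℂ e)
    (c := √(C * (φ (star 1 * 1)).re)) fun y => by simpa [L] using hbound 1 y
  refine ⟨η, by simpa [L] using hrep 1, fun z => ?_⟩
  -- The closure of `M ζ` contains `η` and is invariant under `M`, so the bound on pairings with `y
  -- ζ` may be tested at `z η` itself.
  have hinv : (z : H →L[ℂ] H) η ∈ closure (L.range : Set H) := by
    refine map_mem_closure (z : H →L[ℂ] H).continuous hη ?_
    rintro _ ⟨y, rfl⟩
    exact ⟨z * y, rfl⟩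
  have hle : ∀ w ∈ closure (L.range : Set H),
      ‖⟪(z : H →L[ℂ] H) η, w⟫_ℂ‖ ≤ √(C * (φ (star z * z)).re) * ‖w‖ := by
    have hcl : IsClosed {w : H | ‖⟪(z : H →L[ℂ] H) η, w⟫_ℂ‖ ≤ √(C * (φ (star z * z)).re) * ‖w‖} :=
      isClosed_le (by fun_prop) (by fun_prop)
    refine closure_minimal ?_ hcl
    rintro _ ⟨y, rfl⟩
    have h1 : ⟪(z : H →L[ℂ] H) η, L y⟫_ℂ = φ (star z * (y * e)) := by
      have := hrep (star z * y)
      rw [LinearMap.comp_apply, LinearMap.mulRight_apply, mul_assoc] at this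
      rw [this]
      exact (ContinuousLinearMap.adjoint_inner_right _ _ _).symm
    change ‖⟪(z : H →L[ℂ] H) η, L y⟫_ℂ‖ ≤ √(C * (φ (star z * z)).re) * ‖L y‖
    rw [h1]
    exact hbound z y
  have h2 := hle _ hinv
  rw [inner_self_eq_norm_sq_to_K, norm_pow, RCLike.norm_ofReal, abs_norm] at h2
  have h3 : ‖(z : H →L[ℂ] H) η‖ ≤ √(C * (φ (star z * z)).re) := by
    rcases eq_or_ne ‖(z : H →L[ℂ] H) η‖ 0 with h0 | h0
    · rw [h0]; positivity
    · rw [sq] at h2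
      exact le_of_mul_le_mul_right h2 (lt_of_le_of_ne (norm_nonneg _) h0.symm)
  calc ‖(z : H →L[ℂ] H) η‖ ^ 2 ≤ √(C * (φ (star z * z)).re) ^ 2 := by gcongr
    _ = C * (φ (star z * z)).re := Real.sq_sqrt (mul_nonneg hC (hre z))

/-- The vector functional `x ↦ c ⟪η, x η⟫` on a `*`-subalgebra of `M`. -/
noncomputable def vectorFunctional (N : NonUnitalStarSubalgebra ℂ (Elem M)) (c : ℂ) (η : H) :
    N →ₗ[ℂ] ℂ where
  toFun x := c * ⟪η, ((x : Elem M) : H →L[ℂ] H) η⟫_ℂ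
  map_add' x y := by
    change c * ⟪η, ((x : Elem M) : H →L[ℂ] H) η + ((y : Elem M) : H →L[ℂ] H) η⟫_ℂ = _
    rw [inner_add_right, mul_add]
  map_smul' a x := by
    change c * ⟪η, a • ((x : Elem M) : H →L[ℂ] H) η⟫_ℂ = _
    rw [inner_smul_right, RingHom.id_apply, smul_eq_mul, mul_left_comm]

theorem isNormal_vectorFunctional (N : NonUnitalStarSubalgebra ℂ (Elem M)) (c : ℂ) (η : H) :
    IsNormal (vectorFunctional N c η) := by
  let ξ : ℕ → H := Pi.single 0 η
  have hξ : Summable fun n => ‖ξ n‖ ^ 2 :=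
    summable_of_ne_finset_zero (s := {0}) fun n hn => by
      simp [ξ, Finset.notMem_singleton.1 hn]
  have hsum (x : Elem M) : ∑' n, ⟪ξ n, (x : H →L[ℂ] H) (ξ n)⟫_ℂ = ⟪η, (x : H →L[ℂ] H) η⟫_ℂ := by
    rw [tsum_eq_single 0 fun n hn => by simp [ξ, hn]]
    simp [ξ]
  have hle : ultraweakTopology M ≤ TopologicalSpace.induced
      (fun x : Elem M => ∑' n, ⟪ξ n, (x : H →L[ℂ] H) (ξ n)⟫_ℂ) inferInstance :=
    iInf_le_of_le ξ <| iInf_le_of_le ξ <| iInf_le_of_le hξ <| iInf_le_of_le hξ le_rfl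
  have hcont : @Continuous (Elem M) ℂ (ultraweakTopology M) inferInstance
      fun x : Elem M => ⟪η, (x : H →L[ℂ] H) η⟫_ℂ := by
    rw [continuous_iff_le_induced]
    simpa only [hsum] using hle
  let _ : TopologicalSpace (Elem M) := ultraweakTopology M
  have hval : @Continuous N (Elem M) (TopologicalSpace.induced Subtype.val (ultraweakTopology M))
    (ultraweakTopology M) Subtype.val := continuous_induced_dom
  exact (continuous_const_mul c).comp (hcont.comp hval)

theorem inner_star_mul_self (z : Elem M) (η : H) :
    ⟪η, ((star z * z : Elem M) : H →L[ℂ] H) η⟫_ℂ = ((‖(z : H →L[ℂ] H) η‖ ^ 2 : ℝ) : ℂ) := by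
  change ⟪η, star (z : H →L[ℂ] H) ((z : H →L[ℂ] H) η)⟫_ℂ = _
  rw [ContinuousLinearMap.star_eq_adjoint, ContinuousLinearMap.adjoint_inner_right,
    inner_self_eq_norm_sq_to_K]
  norm_cast

theorem inner_projection {p : Elem M} (hp : IsStarProjection p) (η : H) :
    ⟪η, (p : H →L[ℂ] H) η⟫_ℂ = ((‖(p : H →L[ℂ] H) η‖ ^ 2 : ℝ) : ℂ) := by
  rw [← inner_star_mul_self, hp.isSelfAdjoint.star_eq, hp.isIdempotentElem.eq]

/-- A vector functional dominated by a functional which is singular on `r M r` vanishes at the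
projections below `r`. -/
theorem apply_eq_zero_of_isSingular {r : Elem M} {hr : IsStarProjection r}
    {μ : WeakDual ℂ (Elem M)} (hμ : IsSingular (restrict (corner M r hr) μ))
    (hpos : ∀ x : Elem M, 0 ≤ μ (star x * x)) {C : ℝ} (hC : 0 < C) {η : H}
    (h : ∀ z : Elem M, ‖(z : H →L[ℂ] H) η‖ ^ 2 ≤ C * (μ (star z * z)).re)
    {e : Elem M} (he : IsStarProjection e) (her : e ∈ corner M r hr) :
    (e : H →L[ℂ] H) η = 0 := by
  have hCinv : (0 : ℂ) ≤ ((C⁻¹ : ℝ) : ℂ) := by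
    rw [Complex.zero_le_real]; positivity
  have hval (z : corner M r hr) : vectorFunctional (corner M r hr) ((C⁻¹ : ℝ) : ℂ) η (star z * z) =
      ((C⁻¹ * ‖((z : Elem M) : H →L[ℂ] H) η‖ ^ 2 : ℝ) : ℂ) := by
    rw [Complex.ofReal_mul, ← inner_star_mul_self]
    rfl
  have hzero := hμ.2 (vectorFunctional _ ((C⁻¹ : ℝ) : ℂ) η) (fun z => by
      rw [hval, Complex.zero_le_real]; positivity)
    (isNormal_vectorFunctional _ _ _) (fun z => by
      rw [LinearMap.sub_apply, hval, sub_nonneg]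
      change _ ≤ μ (star (z : Elem M) * (z : Elem M))
      rw [Complex.le_def, ← (Complex.nonneg_iff.1 (hpos z)).2, Complex.ofReal_re, Complex.ofReal_im]
      exact ⟨(inv_mul_le_iff₀ hC).2 (h z), rfl⟩)
  have h1 := congr($hzero ⟨e, her⟩)
  change ((C⁻¹ : ℝ) : ℂ) * ⟪η, (e : H →L[ℂ] H) η⟫_ℂ = 0 at h1
  rw [inner_projection he, ← Complex.ofReal_mul, Complex.ofReal_eq_zero] at h1
  simpa [hC.ne'] using h1

/-! ### Exhaustion by projections for a single functional -/

/-- A nonempty chain of projections has a least upper bound among the projections, and norms at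
vectors pass to it. -/
theorem exists_projection_isChain {c : Set (Elem M)} (hc : IsChain (· ≤ ·) c) (hne : c.Nonempty)
    (hproj : ∀ z ∈ c, IsStarProjection z) :
    ∃ e : Elem M, IsStarProjection e ∧ (∀ z ∈ c, z ≤ e) ∧
      (∀ f : Elem M, IsStarProjection f → (∀ z ∈ c, z ≤ f) → e ≤ f) ∧
      ∀ (v : H) (b : ℝ), (∀ z ∈ c, ‖(z : H →L[ℂ] H) v‖ ≤ b) → ‖(e : H →L[ℂ] H) v‖ ≤ b := by
  have hp (z : c) : IsStarProjection ((z : Elem M) : H →L[ℂ] H) :=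
    coe_isStarProjection (hproj z z.2)
  let U : c → Submodule ℂ H := fun z => ((z : Elem M) : H →L[ℂ] H).range
  have hU (z : c) : ∃ _ : (U z).HasOrthogonalProjection,
      ((z : Elem M) : H →L[ℂ] H) = (U z).starProjection :=
    isStarProjection_iff_eq_starProjection_range.1 (hp z)
  have hinst (z : c) : (U z).HasOrthogonalProjection := (hU z).1
  have hUe (z : c) : (U z).starProjection = ((z : Elem M) : H →L[ℂ] H) := (hU z).2.symm
  have hmono : Monotone U := fun z w hzw => by
    rw [← Submodule.starProjection_le_starProjection_iff, hUe, hUe]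
    exact hzw
  let V := (⨆ z, U z).topologicalClosure
  have hV (z : c) : U z ≤ V := (le_iSup U z).trans (Submodule.le_topologicalClosure _)
  have hVM : V.starProjection ∈ M := by
    refine starProjection_mem V fun y hy v hv => ?_
    refine map_mem_closure y.continuous hv fun w hw => ?_
    suffices h : (⨆ z, U z) ≤ (⨆ z, U z).comap y.toLinearMap from h hw
    refine iSup_le fun z => ?_
    rintro _ ⟨w, rfl⟩
    exact le_iSup U z ⟨y w, congr($((commute_of_mem (z : Elem M).2 hy).eq) w)⟩
  refine ⟨⟨V.starProjection, hVM⟩, isStarProjection_of_coe isStarProjection_starProjection,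
    fun z hz => ?_, fun f hf hzf => ?_, fun v b hb => ?_⟩
  · change (z : H →L[ℂ] H) ≤ V.starProjection
    rw [← hUe ⟨z, hz⟩]
    exact Submodule.starProjection_le_starProjection_iff.2 (hV _)
  · obtain ⟨_, hfW⟩ := isStarProjection_iff_eq_starProjection_range.1 (coe_isStarProjection hf)
    change V.starProjection ≤ (f : H →L[ℂ] H)
    rw [hfW]
    refine Submodule.starProjection_le_starProjection_iff.2 ?_
    refine Submodule.topologicalClosure_minimal _ (iSup_le fun z => ?_)
      (ContinuousLinearMap.IsIdempotentElem.isClosed_range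
        (coe_isStarProjection hf).isIdempotentElem)
    rw [← Submodule.starProjection_le_starProjection_iff, hUe, ← hfW]
    exact hzf z z.2
  · have : Nonempty c := hne.to_subtype
    have : IsDirectedOrder c := ⟨hc.directed⟩
    -- The supremum is the strong limit of the chain.
    have hlim := (Submodule.starProjection_tendsto_closure_iSup U hmono v).norm
    refine le_of_tendsto' hlim fun z => ?_
    rw [hUe]
    exact hb z z.2

/-- A maximal projection at which a positive functional exceeds a multiple of a vector
functional. -/
theorem exists_maximal_projection {φ : Elem M →ₗ[ℂ] ℂ} (hφ : ∀ x : Elem M, 0 ≤ φ (star x * x))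
    {f : Elem M} (hf : IsStarProjection f) (ξ : H) {C : ℝ} (hC : 0 < C) :
    ∃ e : Elem M, IsStarProjection e ∧ IsStarProjection (f - e) ∧
      C * ‖(e : H →L[ℂ] H) ξ‖ ^ 2 ≤ (φ e).re ∧
      ∀ p : Elem M, IsStarProjection p → p ≤ f - e → (φ p).re ≤ C * ‖(p : H →L[ℂ] H) ξ‖ ^ 2 := by
  let s : Set (Elem M) :=
    {e | IsStarProjection e ∧ e ≤ f ∧ C * ‖(e : H →L[ℂ] H) ξ‖ ^ 2 ≤ (φ e).re}
  have hf0 : (0 : Elem M) ≤ f := (coe_isStarProjection hf).nonneg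
  obtain ⟨e, ⟨he, hef, heC⟩, hmax⟩ := zorn_le₀ s fun c hcs hc => by
    rcases c.eq_empty_or_nonempty with rfl | hne
    · exact ⟨0, ⟨.zero _, hf0, by simp⟩, by simp⟩
    obtain ⟨e, he, hub, hleast, hnorm⟩ := exists_projection_isChain hc hne fun z hz => (hcs hz).1
    refine ⟨e, ⟨he, hleast f hf fun z hz => (hcs hz).2.1, ?_⟩, hub⟩
    -- Normality of `φ` is not needed: monotonicity gives `φ z ≤ φ e`, and only the norm at `ξ` has
    -- to pass to the limit.
    have hle := hnorm ξ √((φ e).re / C) fun z hz => by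
      refine Real.le_sqrt_of_sq_le ?_
      rw [le_div_iff₀' hC]
      exact (hcs hz).2.2.trans (re_map_mono hφ (hub z hz))
    have hnn : 0 ≤ (φ e).re / C :=
      div_nonneg (Complex.nonneg_iff.1
        (map_nonneg_of_nonneg hφ (coe_isStarProjection he).nonneg)).1 hC.le
    calc C * ‖(e : H →L[ℂ] H) ξ‖ ^ 2 ≤ C * √((φ e).re / C) ^ 2 := by gcongr
      _ = (φ e).re := by rw [Real.sq_sqrt hnn]; field_simp
  have hef' : (f * e : Elem M) = e := Subtype.ext
    (((coe_isStarProjection he).le_iff_mul_eq_right (coe_isStarProjection hf)).1 hef)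
  have hfe : IsStarProjection (f - e) := he.sub_of_mul_eq_right hf hef'
  refine ⟨e, he, hfe, heC, fun p hp hpe => ?_⟩
  by_contra! hlt
  have hpe' : (f - e) * p = p := Subtype.ext
    (((coe_isStarProjection hp).le_iff_mul_eq_right (coe_isStarProjection hfe)).1 hpe)
  have hep : e * p = 0 := by
    have h1 : e * (f - e) = 0 := by
      have : e * f = e := by
        simpa [he.isSelfAdjoint.star_eq, hf.isSelfAdjoint.star_eq] using congr(star $hef')
      rw [mul_sub, this, he.isIdempotentElem.eq, sub_self]
    rw [← hpe', ← mul_assoc, h1, zero_mul]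
  have hsum := he.add hp hep
  have hmem : e + p ∈ s := by
    refine ⟨hsum, by simpa using add_le_add_right hpe e, ?_⟩
    have hpyth : ‖((e + p : Elem M) : H →L[ℂ] H) ξ‖ ^ 2 =
        ‖(e : H →L[ℂ] H) ξ‖ ^ 2 + ‖(p : H →L[ℂ] H) ξ‖ ^ 2 := by
      have h1 := inner_projection hsum ξ
      change ⟪ξ, (e : H →L[ℂ] H) ξ + (p : H →L[ℂ] H) ξ⟫_ℂ = _ at h1
      rw [inner_add_right, inner_projection he, inner_projection hp] at h1
      exact_mod_cast h1.symm
    rw [hpyth, map_add, Complex.add_re, mul_add]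
    exact add_le_add heC hlt.le
  have hp0 : 0 ≤ p := (coe_isStarProjection hp).nonneg
  have hle : e + p ≤ e := hmax hmem (by simpa using hp0)
  have : p = 0 := le_antisymm (by simpa using hle) hp0
  simp [this] at hlt

/-- Domination of a positive functional by a vector functional on the corner of `e` follows from
domination at projections. -/
theorem re_map_le_of_le_projection {φ : Elem M →ₗ[ℂ] ℂ} (hb : ∀ x, ‖φ x‖ ≤ ‖x‖)
    {e : Elem M} (he : IsStarProjection e) {ξ : H} {C : ℝ} (hC : 0 ≤ C)
    (h : ∀ p : Elem M, IsStarProjection p → p ≤ e → (φ p).re ≤ C * ‖(p : H →L[ℂ] H) ξ‖ ^ 2)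
    (y : Elem M) : (φ (star (y * e) * (y * e))).re ≤
      C * ‖(y : H →L[ℂ] H) ((e : H →L[ℂ] H) ξ)‖ ^ 2 := by
  let l : Elem M →+ ℝ :=
    { toFun := fun x => (φ x).re - C * (⟪ξ, (x : H →L[ℂ] H) ξ⟫_ℂ).re
      map_zero' := by simp
      map_add' := fun x z => by
        change (φ (x + z)).re - C * (⟪ξ, (x : H →L[ℂ] H) ξ + (z : H →L[ℂ] H) ξ⟫_ℂ).re = _
        rw [inner_add_right, map_add, Complex.add_re, Complex.add_re]
        ring }
  have hl : ∀ x, ‖x‖ ≤ 1 → l x ≤ 1 + C * (‖ξ‖ * ‖ξ‖) := fun x hx => by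
    have h1 : (φ x).re ≤ 1 := (Complex.re_le_norm _).trans ((hb x).trans hx)
    have h2 : -(⟪ξ, (x : H →L[ℂ] H) ξ⟫_ℂ).re ≤ ‖ξ‖ * ‖ξ‖ := by
      refine (neg_le_abs _).trans ((Complex.abs_re_le_norm _).trans ((norm_inner_le_norm _ _).trans ?_))
      gcongr
      have := (x : H →L[ℂ] H).le_opNorm ξ
      have hx' : ‖(x : H →L[ℂ] H)‖ ≤ 1 := hx
      nlinarith [norm_nonneg ξ]
    change (φ x).re - C * (⟪ξ, (x : H →L[ℂ] H) ξ⟫_ℂ).re ≤ _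
    nlinarith
  have hproj : ∀ p : Elem M, IsStarProjection p → p ≤ e → l p ≤ 0 := fun p hp hpe => by
    change (φ p).re - C * (⟪ξ, (p : H →L[ℂ] H) ξ⟫_ℂ).re ≤ 0
    rw [inner_projection hp, Complex.ofReal_re, sub_nonpos]
    exact h p hp hpe
  obtain ⟨n, hn⟩ := exists_nat_ge (‖(star y * y : Elem M)‖)
  -- This scaling brings `star (y * e) * (y * e)` below `e`; the `+ 1` keeps `t` positive even when
  -- `n = 0`.
  let t : ℝ := (n + 1 : ℝ)⁻¹
  have ht : 0 < t := by positivity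
  have he' := coe_isStarProjection he
  have heq : ((star (y * e) * (y * e) : Elem M) : H →L[ℂ] H) =
      star (e : H →L[ℂ] H) * (star (y : H →L[ℂ] H) * y) * e := by
    change star ((y : H →L[ℂ] H) * e) * ((y : H →L[ℂ] H) * e) = _
    simp only [star_mul, mul_assoc]
  have hcoe : (((t : ℂ) • (star (y * e) * (y * e)) : Elem M) : H →L[ℂ] H) =
      t • (star (e : H →L[ℂ] H) * (star (y : H →L[ℂ] H) * y) * e) := by
    rw [← heq, ← Complex.coe_smul]
    rfl
  have hnn : 0 ≤ ((t : ℂ) • (star (y * e) * (y * e)) : Elem M) := by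
    change (0 : H →L[ℂ] H) ≤ _
    rw [hcoe]
    exact smul_nonneg ht.le (star_left_conjugate_nonneg (star_mul_self_nonneg _) _)
  have hsmul : ((t : ℂ) • (star (y * e) * (y * e)) : Elem M) ≤ e := by
    change _ ≤ (e : H →L[ℂ] H)
    rw [hcoe]
    have h1 : star (e : H →L[ℂ] H) * (star (y : H →L[ℂ] H) * y) * e ≤
        ‖star (y : H →L[ℂ] H) * y‖ • (e : H →L[ℂ] H) := by
      have := CStarAlgebra.star_left_conjugate_le_norm_smul (a := (e : H →L[ℂ] H))
        (b := star (y : H →L[ℂ] H) * y) (.star_mul_self _)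
      rw [he'.isSelfAdjoint.star_eq, he'.isIdempotentElem.eq] at this
      rwa [he'.isSelfAdjoint.star_eq]
    have hn' : ‖star (y : H →L[ℂ] H) * y‖ ≤ n := hn
    have h2 : ‖star (y : H →L[ℂ] H) * y‖ • (e : H →L[ℂ] H) ≤ t⁻¹ • (e : H →L[ℂ] H) :=
      smul_le_smul_of_nonneg_right (by simp only [t, inv_inv]; linarith) he'.nonneg
    have h3 := smul_le_smul_of_nonneg_left (h1.trans h2) ht.le
    rwa [smul_inv_smul₀ ht.ne'] at h3
  have h1 := nonpos_of_nonpos_projection l hl he hproj hnn hsmul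
  change (φ ((t : ℂ) • (star (y * e) * (y * e)))).re -
    C * (⟪ξ, (t : ℂ) • (((star (y * e) * (y * e)) : Elem M) : H →L[ℂ] H) ξ⟫_ℂ).re ≤ 0 at h1
  rw [inner_smul_right, inner_star_mul_self, map_smul, smul_eq_mul, Complex.re_ofReal_mul,
    Complex.re_ofReal_mul, Complex.ofReal_re] at h1
  have h2 : t * (φ (star (y * e) * (y * e))).re ≤
      t * (C * ‖((y * e : Elem M) : H →L[ℂ] H) ξ‖ ^ 2) := by linarith
  exact le_of_mul_le_mul_left h2 ht

theorem mem_corner_of_le {r : Elem M} {hr : IsStarProjection r} {f e : Elem M}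
    (hf : IsStarProjection f) (hfr : f ∈ corner M r hr) (he0 : 0 ≤ e) (hef : e ≤ f) :
    e ∈ corner M r hr := by
  have h : f * e * f = e :=
    Subtype.ext ((coe_isStarProjection hf).conjugate_of_nonneg_of_le he0 hef)
  obtain ⟨y, hy⟩ := hfr
  refine ⟨y * r * e * r * y, ?_⟩
  calc e = f * e * f := h.symm
    _ = r * y * r * e * (r * y * r) := by rw [hy]
    _ = r * (y * r * e * r * y) * r := by simp only [mul_assoc]

theorem norm_apply_le_of_mem_ball {μ : WeakDual ℂ (Elem M)} (hμ : μ ∈ positiveUnitBall M)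
    (x : Elem M) : ‖μ x‖ ≤ ‖x‖ := by
  have := (WeakDual.toStrongDual μ).le_of_opNorm_le hμ.1 x
  simpa using this

theorem re_inner_mono {x y : Elem M} (hxy : x ≤ y) (ξ : H) :
    (⟪ξ, (x : H →L[ℂ] H) ξ⟫_ℂ).re ≤ (⟪ξ, (y : H →L[ℂ] H) ξ⟫_ℂ).re := by
  have h : ((y : H →L[ℂ] H) - x).IsPositive := hxy
  have := h.re_inner_nonneg_right ξ
  rw [sub_apply, inner_sub_right, map_sub] at this
  exact sub_nonneg.1 this

/-- A singular functional vanishes at projections approximating `f` in a given vector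
functional. -/
theorem exists_projection_apply_eq_zero {r : Elem M} {hr : IsStarProjection r}
    {μ : WeakDual ℂ (Elem M)} (hμ : μ ∈ positiveUnitBall M)
    (hsing : IsSingular (restrict (corner M r hr) μ)) {f : Elem M} (hf : IsStarProjection f)
    (hfr : f ∈ corner M r hr) (ξ : H) {ε : ℝ} (hε : 0 < ε) :
    ∃ e : Elem M, IsStarProjection e ∧ e ≤ f ∧ μ e = 0 ∧
      (⟪ξ, ((f - e : Elem M) : H →L[ℂ] H) ξ⟫_ℂ).re ≤ ε := by
  let φ : Elem M →ₗ[ℂ] ℂ := (WeakDual.toStrongDual μ : Elem M →L[ℂ] ℂ).toLinearMap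
  have hφ : ∀ x : Elem M, 0 ≤ φ (star x * x) := hμ.2
  obtain ⟨e, he, hfe, heC, hmax⟩ := exists_maximal_projection hφ hf ξ (inv_pos.2 hε)
  have he0 : 0 ≤ e := (coe_isStarProjection he).nonneg
  have hfe0 : 0 ≤ f - e := (coe_isStarProjection hfe).nonneg
  have hle : f - e ≤ f := by simpa using he0
  refine ⟨f - e, hfe, hle, ?_, ?_⟩
  · obtain ⟨η, hη, hz⟩ := exists_vector_functional_le hφ (inv_pos.2 hε).le
      (re_map_le_of_le_projection (norm_apply_le_of_mem_ball hμ) hfe (inv_pos.2 hε).le hmax)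
    have h0 := apply_eq_zero_of_isSingular hsing hμ.2 (inv_pos.2 hε) hz hfe
      (mem_corner_of_le hf hfr hfe0 hle)
    change φ (f - e) = 0
    -- Moving the projection across gives `⟪η, (f - e) ξ⟫ = ⟪(f - e) η, ξ⟫ = 0`.
    rw [hη, ← (coe_isStarProjection hfe).isSelfAdjoint.adjoint_eq,
      ContinuousLinearMap.adjoint_inner_right, h0, inner_zero_left]
  · rw [sub_sub_cancel, inner_projection he, Complex.ofReal_re]
    have h1 : (φ e).re ≤ 1 := (Complex.re_le_norm _).trans
      ((norm_apply_le_of_mem_ball hμ e).trans (norm_le_one_of_le_projection he he0 le_rfl))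
    have h2 := heC.trans h1
    rwa [inv_mul_le_iff₀ hε, mul_one] at h2

/-! ### Minimax and uniformity over `K` -/

/-- Minimax for a separately continuous bilinear form on a compact convex set and a convex set. -/
theorem exists_forall_lt_of_forall_exists_lt {E F : Type*} [TopologicalSpace E] [AddCommGroup E]
    [Module ℝ E] [IsTopologicalAddGroup E] (hE : ContinuousSMul ℝ E) [TopologicalSpace F]
    [AddCommGroup F] [Module ℝ F] [IsTopologicalAddGroup F] [ContinuousSMul ℝ F] {X : Set E}
    {Y : Set F} (hne : X.Nonempty) (hX : IsCompact X) (hXc : Convex ℝ X) (hY : Convex ℝ Y)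
    (B : E → F → ℝ) (hB : ∀ y, Continuous fun x => B x y) (hB' : ∀ x, Continuous (B x))
    (hBl : ∀ y, IsLinearMap ℝ fun x => B x y) (hBl' : ∀ x, IsLinearMap ℝ (B x)) {t : ℝ}
    (h : ∀ x ∈ X, ∃ y ∈ Y, B x y < t) : ∃ y ∈ Y, ∀ x ∈ X, B x y < t := by
  obtain ⟨s, hsY, hs, hXs⟩ := hX.elim_finite_subcover_image (b := Y) (c := fun y => {x | B x y < t})
    (fun y _ => isOpen_lt (hB y) continuous_const) (fun x hx => by
      obtain ⟨y, hy, hlt⟩ := h x hx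
      exact Set.mem_biUnion hy hlt)
  -- The finite form of Sion's theorem bounds from below, hence the change of sign.
  obtain ⟨y, hy, hyX⟩ := Sion.exists_lt_iInf_of_lt_iInf_of_finite (X := X) (Y := Y)
    (f := fun x y => -B x y) hne hX
    (fun y _ => (hB y).neg.lowerSemicontinuous.lowerSemicontinuousOn _)
    (fun y _ => (-(hBl y).mk' _).convexOn hXc |>.quasiconvexOn) hY
    (fun x _ => (hB' x).neg.upperSemicontinuous.upperSemicontinuousOn _)
    (fun x _ => (-(hBl' x).mk' _).concaveOn hY |>.quasiconcaveOn) hXc hs hsY (t := -t)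
    (fun x hx => by
      obtain ⟨y, hy, hlt⟩ := Set.mem_iUnion₂.1 (hXs hx)
      exact ⟨y, hy, neg_lt_neg hlt⟩)
  exact ⟨y, hy, fun x hx => neg_lt_neg_iff.1 (hyX x hx)⟩

/-- A minimax argument makes the approximation uniform over a compact convex set. -/
theorem exists_forall_apply_lt {r : Elem M} {hr : IsStarProjection r}
    {K : Set (WeakDual ℂ (Elem M))} (hKball : K ⊆ positiveUnitBall M) (hKcompact : IsCompact K)
    (hKconvex : Convex ℝ K) (hKsing : ∀ μ ∈ K, IsSingular (restrict (corner M r hr) μ))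
    {f : Elem M} (hf : IsStarProjection f) (hfr : f ∈ corner M r hr) (ξ : H) {ε δ : ℝ}
    (hε : 0 < ε) (hδ : 0 < δ) :
    ∃ x : Elem M, 0 ≤ x ∧ x ≤ f ∧ (⟪ξ, ((f - x : Elem M) : H →L[ℂ] H) ξ⟫_ℂ).re ≤ ε ∧
      ∀ μ ∈ K, (μ x).re < δ := by
  have hf0 : 0 ≤ f := (coe_isStarProjection hf).nonneg
  rcases K.eq_empty_or_nonempty with rfl | hne
  · exact ⟨f, hf0, le_rfl, by simpa using hε.le, by simp⟩
  -- Projections do not form a convex set; this relaxation is convex and contains those supplied by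
  -- `exists_projection_apply_eq_zero`.
  let Y : Set (Elem M) :=
    {x | 0 ≤ x ∧ x ≤ f ∧ (⟪ξ, ((f - x : Elem M) : H →L[ℂ] H) ξ⟫_ℂ).re ≤ ε}
  have hY : Convex ℝ Y := by
    rintro x ⟨hx0, hxf, hx⟩ y ⟨hy0, hyf, hy⟩ a b ha hb hab
    have hx0' : (0 : H →L[ℂ] H) ≤ x := hx0
    have hy0' : (0 : H →L[ℂ] H) ≤ y := hy0
    have hxf' : (x : H →L[ℂ] H) ≤ f := hxf
    have hyf' : (y : H →L[ℂ] H) ≤ f := hyf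
    refine ⟨?_, ?_, ?_⟩
    · change (0 : H →L[ℂ] H) ≤ a • (x : H →L[ℂ] H) + b • (y : H →L[ℂ] H)
      exact add_nonneg (smul_nonneg ha hx0') (smul_nonneg hb hy0')
    · change a • (x : H →L[ℂ] H) + b • (y : H →L[ℂ] H) ≤ (f : H →L[ℂ] H)
      calc _ ≤ a • (f : H →L[ℂ] H) + b • (f : H →L[ℂ] H) := by gcongr
        _ = f := by rw [← add_smul, hab, one_smul]
    · have h1 : f - (a • x + b • y) = a • (f - x) + b • (f - y) := by
        rw [smul_sub, smul_sub, sub_add_sub_comm, ← add_smul, hab, one_smul]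
      rw [h1]
      change (⟪ξ, a • ((f - x : Elem M) : H →L[ℂ] H) ξ + b • ((f - y : Elem M) : H →L[ℂ] H) ξ⟫_ℂ).re
        ≤ ε
      rw [inner_add_right, inner_smul_right_eq_smul, inner_smul_right_eq_smul, Complex.add_re,
        Complex.smul_re, Complex.smul_re, smul_eq_mul, smul_eq_mul]
      calc _ ≤ a * ε + b * ε := by gcongr
        _ = ε := by rw [← add_mul, hab, one_mul]
  obtain ⟨x, hx, hxK⟩ := exists_forall_lt_of_forall_exists_lt
    ⟨WeakDual.continuous_of_continuous_eval fun x =>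
      continuous_fst.smul ((WeakDual.eval_continuous x).comp continuous_snd)⟩
    hne hKcompact hKconvex hY (fun μ x => (μ x).re)
    (fun x => Complex.continuous_re.comp (WeakDual.eval_continuous x))
    (fun μ => Complex.continuous_re.comp (WeakDual.toStrongDual μ).continuous)
    (fun x => ⟨fun μ ν => Complex.add_re (μ x) (ν x), fun c μ => Complex.smul_re c (μ x)⟩)
    (fun μ => ⟨fun x y => by rw [map_add, Complex.add_re], fun c x => by
      have h : c • x = (c : ℂ) • x := rfl
      rw [h, map_smul, smul_eq_mul, Complex.re_ofReal_mul, smul_eq_mul]⟩)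
    (t := δ) (fun μ hμ => by
      obtain ⟨e, he, hef, h0, hξ⟩ :=
        exists_projection_apply_eq_zero (hKball hμ) (hKsing μ hμ) hf hfr ξ hε
      exact ⟨e, ⟨(coe_isStarProjection he).nonneg, hef, hξ⟩, by simpa [h0] using hδ⟩)
  exact ⟨x, hx.1, hx.2.1, hx.2.2, hxK⟩

theorem exists_projection_forall_apply_le {r : Elem M} {hr : IsStarProjection r}
    {K : Set (WeakDual ℂ (Elem M))} (hKball : K ⊆ positiveUnitBall M) (hKcompact : IsCompact K)
    (hKconvex : Convex ℝ K) (hKsing : ∀ μ ∈ K, IsSingular (restrict (corner M r hr) μ))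
    {f : Elem M} (hf : IsStarProjection f) (hfr : f ∈ corner M r hr) (ξ : H) {ε δ : ℝ}
    (hε : 0 < ε) (hδ : 0 < δ) :
    ∃ q : Elem M, IsStarProjection q ∧ q ≤ f ∧
      ‖(f : H →L[ℂ] H) ξ - (q : H →L[ℂ] H) ξ‖ ≤ ε ∧ ∀ μ ∈ K, (μ q).re ≤ δ := by
  -- The halves absorb the factor two in `q ≤ x + x` and `f - q ≤ (f - x) + (f - x)`; the square
  -- appears because the vector functional at `f - q` is `‖(f - q) ξ‖²`.
  obtain ⟨x, hx0, hxf, hx, hxK⟩ := exists_forall_apply_lt hKball hKcompact hKconvex hKsing hf hfr ξ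
    (ε := ε ^ 2 / 2) (by positivity) (half_pos hδ)
  obtain ⟨q, hq, hqf, hqx, hfq⟩ := exists_half_spectral_projection_le hf hx0 hxf
  refine ⟨q, hq, hqf, ?_, fun μ hμ => ?_⟩
  · have hsub : IsStarProjection (f - q) := hq.sub_of_mul_eq_right hf (Subtype.ext
      (((coe_isStarProjection hq).le_iff_mul_eq_right (coe_isStarProjection hf)).1 hqf))
    have h1 := re_inner_mono hfq ξ
    rw [inner_projection hsub, Complex.ofReal_re] at h1
    change ‖((f - q : Elem M) : H →L[ℂ] H) ξ‖ ≤ ε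
    refine abs_le_of_sq_le_sq' (h1.trans ?_) hε.le |>.2
    change (⟪ξ, ((f - x : Elem M) : H →L[ℂ] H) ξ + ((f - x : Elem M) : H →L[ℂ] H) ξ⟫_ℂ).re ≤ _
    rw [inner_add_right, Complex.add_re]
    linarith
  · have h1 := re_map_mono (φ := (WeakDual.toStrongDual μ : Elem M →L[ℂ] ℂ).toLinearMap)
      (hKball hμ).2 hqx
    rw [map_add, Complex.add_re] at h1
    have h2 := hxK μ hμ
    change (μ q).re ≤ (μ x).re + (μ x).re at h1
    linarith

/-! ### Infimum of a decreasing sequence of projections -/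

/-- A weak*-compact convex set of positive functionals that are singular on `r M r` vanishes at a
nonzero projection below any given nonzero projection of `r M r`. -/
theorem exists_projection_forall_apply_eq_zero {r : Elem M} {hr : IsStarProjection r}
    {K : Set (WeakDual ℂ (Elem M))} (hKball : K ⊆ positiveUnitBall M) (hKcompact : IsCompact K)
    (hKconvex : Convex ℝ K) (hKsing : ∀ μ ∈ K, IsSingular (restrict (corner M r hr) μ))
    {f : Elem M} (hfr : f ∈ corner M r hr) (hf : IsStarProjection f) (hf0 : f ≠ 0) :
    ∃ p : Elem M, IsStarProjection p ∧ p ≠ 0 ∧ p ≤ f ∧ ∀ μ ∈ K, μ p = 0 := by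
  obtain ⟨v, hv⟩ : ∃ v, (f : H →L[ℂ] H) v ≠ 0 := by
    by_contra! h
    exact hf0 (Subtype.ext (ContinuousLinearMap.ext h))
  set ξ := (f : H →L[ℂ] H) v with hξ
  have hfξ : (f : H →L[ℂ] H) ξ = ξ := congr($((coe_isStarProjection hf).isIdempotentElem.eq) v)
  set a := ‖ξ‖
  have ha : 0 < a := norm_pos_iff.2 hv
  let S := {q : Elem M // IsStarProjection q ∧ q ≤ f}
  -- The losses `a / 4 * (1 / 2) ^ n` at the fixed vector `ξ` add up to `a / 2`, less than `‖ξ‖ =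
  -- a`.
  have hstep (n : ℕ) (q : S) : ∃ q' : S, q'.1 ≤ q.1 ∧
      ‖(q.1 : H →L[ℂ] H) ξ - (q'.1 : H →L[ℂ] H) ξ‖ ≤ a / 4 * (1 / 2) ^ n ∧
      ∀ μ ∈ K, (μ q'.1).re ≤ (1 / 2) ^ n := by
    obtain ⟨q', h1, h2, h3, h4⟩ := exists_projection_forall_apply_le hKball hKcompact hKconvex
      hKsing q.2.1 (mem_corner_of_le hf hfr (coe_isStarProjection q.2.1).nonneg q.2.2) ξ
      (ε := a / 4 * (1 / 2) ^ n) (δ := (1 / 2) ^ n) (by positivity) (by positivity)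
    exact ⟨⟨q', h1, h2.trans q.2.2⟩, h2, h3, h4⟩
  choose g hg hgξ hgK using hstep
  let q : ℕ → S := fun n => Nat.rec ⟨f, hf, le_rfl⟩ g n
  have hanti : Antitone fun n => (q n).1 := antitone_nat_of_succ_le fun n => hg n (q n)
  have hnorm (n : ℕ) : ‖ξ - ((q n).1 : H →L[ℂ] H) ξ‖ ≤ a / 2 * (1 - (1 / 2) ^ n) := by
    induction n with
    | zero => simp [q, hfξ]
    | succ n ih =>
      calc _ ≤ ‖ξ - ((q n).1 : H →L[ℂ] H) ξ‖ +
            ‖((q n).1 : H →L[ℂ] H) ξ - ((q (n + 1)).1 : H →L[ℂ] H) ξ‖ :=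
            norm_sub_le_norm_sub_add_norm_sub _ _ _
        _ ≤ a / 2 * (1 - (1 / 2) ^ n) + a / 4 * (1 / 2) ^ n := add_le_add ih (hgξ n (q n))
        _ = _ := by ring
  have hmono : Monotone fun n => 1 - (q n).1 := fun m n h => sub_le_sub_left (hanti h) 1
  -- The infimum of the `q n` is obtained as `1 - e`, with `e` the supremum of the complements; `‖e
  -- ξ‖ ≤ a / 2` excludes `e = 1`.
  obtain ⟨e, he, hub, -, hbound⟩ := exists_projection_isChain
    (c := Set.range fun n => 1 - (q n).1) hmono.isChain_range (Set.range_nonempty _) (by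
      rintro _ ⟨n, rfl⟩
      exact (q n).2.1.one_sub)
  have hpq (n : ℕ) : 1 - e ≤ (q n).1 := by
    have := hub _ ⟨n, rfl⟩
    exact sub_le_comm.1 this
  refine ⟨1 - e, he.one_sub, fun h0 => ?_, hpq 0, fun μ hμ => ?_⟩
  · have he1 : e = 1 := (sub_eq_zero.1 h0).symm
    have h1 := hbound ξ (a / 2) (by
      rintro _ ⟨n, rfl⟩
      refine (hnorm n).trans ?_
      have : (0 : ℝ) < (1 / 2) ^ n := by positivity
      nlinarith)
    rw [he1] at h1
    change a ≤ a / 2 at h1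
    linarith
  · let φ : Elem M →ₗ[ℂ] ℂ := (WeakDual.toStrongDual μ : Elem M →L[ℂ] ℂ).toLinearMap
    have hφ : ∀ x : Elem M, 0 ≤ φ (star x * x) := (hKball hμ).2
    have h0 := map_nonneg_of_nonneg hφ (coe_isStarProjection he.one_sub).nonneg
    have h1 : (φ (1 - e)).re ≤ 0 := by
      refine ge_of_tendsto' (tendsto_pow_atTop_nhds_zero_of_lt_one (r := (1 / 2 : ℝ))
        (by norm_num) (by norm_num)) fun n => ?_
      -- The index is shifted because `q 0 = f` carries no estimate; the `n`-th bound holds at `q (n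
      -- + 1)`.
      exact (re_map_mono hφ (hpq (n + 1))).trans (hgK n (q n) μ hμ)
    rw [Complex.nonneg_iff] at h0
    exact Complex.ext (le_antisymm h1 h0.1) h0.2.symm

end VNA

theorem lemma3p4 {H : Type*} [NormedAddCommGroup H] [InnerProductSpace ℂ H] [CompleteSpace H]
    (M : VonNeumannAlgebra H) (τ : VNA.Elem M → ENNReal) (hτ : VNA.IsFNSTrace M τ)
    (r : VNA.Elem M) (hr : IsStarProjection r) (hr0 : r ≠ 0)
    (K : Set (WeakDual ℂ (VNA.Elem M))) (hKball : K ⊆ VNA.positiveUnitBall M)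
    (hKcompact : IsCompact K) (hKconvex : Convex ℝ K)
    (hKsing : ∀ μ ∈ K, VNA.IsSingular (VNA.restrict (VNA.corner M r hr) μ)) :
    ∀ f ∈ VNA.corner M r hr, IsStarProjection f → f ≠ 0 →
      ∃ p : VNA.Elem M, IsStarProjection p ∧ p ≠ 0 ∧ p ≤ f ∧ ∀ μ ∈ K, μ p = 0 :=
  fun _ hfr hf hf0 => VNA.exists_projection_forall_apply_eq_zero hKball hKcompact hKconvex hKsing
    hfr hf hf0
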